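/- **Theorem 3.** Let $\mathrm{Im}\,\tau>0$, let $\theta_1,\dots,\theta_4$ be the Jacobi theta functions $$\theta_1(u|\tau)=-i\sum_{k\in\mathbb Z}(-1)^ke^{\pi i\tau(k+\frac12)^2}e^{\pi i(2k+1)u},\quad \theta_2(u|\tau)=\sum_{k\in\mathbb Z}e^{\pi i\tau(k+\frac12)^2}e^{\pi i(2k+1)u},$$ $$\theta_3(u|\tau)=\sum_{k\in\mathbb Z}e^{\pi i\tau k^2}e^{2\pi iku},\quad \theta_4(u|\tau)=\sum_{k\in\mathbb Z}(-1)^ke^{\pi i\tau k^2}e^{2\pi iku},$$ with $\theta_a(u)=\theta_a(u|\tau)$, and put $\phi(x,u)=\frac{\theta_1'(0)\theta_1(x+u)}{\theta_1(x)\theta_1(u)}$, $(\omega_0,\omega_1,\omega_2,\omega_3)=(0,\frac12,\frac{1+\tau}2,\frac\tau2)$, $\varphi_a(x,u+\omega_a)=e^{2\pi i x\,\partial_\tau\omega_a}\phi(x,u+\omega_a)$. Let $c\in\mathbb C\setminus\{0\}$, let $\eta,\bar\eta,\nu_a,\bar\nu_a\in\mathbb C$ ($a=0,\dots,3$) be constants,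 and let $v(x,u)=\sum_{a=0}^3\nu_a\varphi_a(2x,u+\omega_a)$, let $\bar v$ be the same function with $\bar\nu_a$ in place of $\nu_a$, and $$\begin{aligned}\breve\nu_0&=\tfrac12(\nu_0+\nu_1+\nu_2+\nu_3),&\breve\nu_1&=\tfrac12(\nu_0+\nu_1-\nu_2-\nu_3),\\ \breve\nu_2&=\tfrac12(\nu_0-\nu_1+\nu_2-\nu_3),&\breve\nu_3&=\tfrac12(\nu_0-\nu_1-\nu_2+\nu_3).\end{aligned}$$ Let $p,q\in\mathbb C$ be the dynamical variables and $z\in\mathbb C$ the spectral parameter. Chalykh's Lax matrix $$\mathcal L^{\rm Ch}(z)=\begin{pmatrix}v(\eta,q)&-v(z,q)\\-v(z,-q)&v(\eta,-q)\end{pmatrix}\begin{pmatrix}\bar v(\bar\eta,q)e^{p/c}&-\bar v(z,q)\\-\bar v(z,-q)&\bar v(\bar\eta,-q)e^{-p/c}\end{pmatrix}$$ factorizes as $\mathcal L^{\rm Ch}(z)=\mathbf L(z)\bar{\mathbf L}(z)$ with $$\mathbf L(z)=\begin{pmatrix}v(\eta,q)e^{p/2c}&-v(z,q)e^{-p/2c}\\-v(z,-q)e^{p/2c}&v(\eta,-q)e^{-p/2c}\end{pmatrix}$$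 and $\bar{\mathbf L}(z)$ the same matrix with $\bar\eta,\bar\nu_a$ in place of $\eta,\nu_a$. Let $$\Xi_\eta(z)=\begin{pmatrix}\theta_3(z+\eta-2q|2\tau)&-\theta_3(z+\eta+2q|2\tau)\\-\theta_2(z+\eta-2q|2\tau)&\theta_2(z+\eta+2q|2\tau)\end{pmatrix},\qquad \mathbf L'(z)=\Xi_\eta(z)\mathbf L(z)\Xi_\eta^{-1}(z),$$ $$\mathbf S_a=\tfrac12\Big(\varphi_a(2q,\eta+\omega_a)e^{p/2c}+\varphi_a(-2q,\eta+\omega_a)e^{-p/2c}\Big),\qquad a=0,1,2,3.$$ Assume that $2z,\,2\eta,\,2\bar\eta,\,2q$ and $z+\eta$ are not in $\mathbb Z+\tau\mathbb Z$ (the condition on $\bar\eta$ only concerns $\bar{\mathbf L}$). Then $\Xi_\eta(z)$ is invertible, $\Xi_\eta(z)\mathcal L^{\rm Ch}(z)\Xi_\eta^{-1}(z)=\mathbf L'(z)\cdot\Xi_\eta(z)\bar{\mathbf L}(z)\Xi_\eta^{-1}(z)$, and the matrix $\mathbf L'(z)$ depends on $p,q$ only through $\mathbf S_0,\dots,\mathbf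 S_3$. Explicitly, with $g_{ab}=\frac{\theta_a(\eta)}{\theta_b(\eta)}\frac{\theta_a(z)}{\theta_b(z)}$, $$\mathbf L'(z)_{11}=\sum_{a=0}^3\breve\nu_a\mathbf S_a-A,\qquad \mathbf L'(z)_{22}=\sum_{a=0}^3\breve\nu_a\mathbf S_a+A,\qquad \mathbf L'(z)_{12}=B+C,\qquad \mathbf L'(z)_{21}=-B+C,$$ where $$A=\breve\nu_0\mathbf S_1g_{21}+\breve\nu_1\mathbf S_0g_{12}+\breve\nu_2\mathbf S_3g_{43}+\breve\nu_3\mathbf S_2g_{34},$$ $$B=-\breve\nu_0\mathbf S_2g_{31}+\breve\nu_1\mathbf S_3g_{42}+\breve\nu_2\mathbf S_0g_{13}-\breve\nu_3\mathbf S_1g_{24},$$ $$C=-\breve\nu_0\mathbf S_3g_{41}+\breve\nu_1\mathbf S_2g_{32}+\breve\nu_2\mathbf S_1g_{23}-\breve\nu_3\mathbf S_0g_{14}.$$ -/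

import Mathlib

noncomputable section

namespace BC1

/-- The Jacobi theta function `θ₁(u|τ)` with half-integer powers of the nome `exp (π i τ)`. -/
def theta1 (u τ : ℂ) : ℂ :=
  -Complex.I * ∑' k : ℤ, (-1 : ℂ) ^ k *
    Complex.exp (Real.pi * Complex.I * τ * ((k : ℂ) + 1 / 2) ^ 2) *
    Complex.exp (Real.pi * Complex.I * (2 * (k : ℂ) + 1) * u)

/-- The Jacobi theta function `θ₂(u|τ)`. -/
def theta2 (u τ : ℂ) : ℂ :=
  ∑' k : ℤ,
    Complex.exp (Real.pi * Complex.I * τ * ((k : ℂ) + 1 / 2) ^ 2) *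
    Complex.exp (Real.pi * Complex.I * (2 * (k : ℂ) + 1) * u)

/-- The Jacobi theta function `θ₃(u|τ)`. -/
def theta3 (u τ : ℂ) : ℂ :=
  ∑' k : ℤ,
    Complex.exp (Real.pi * Complex.I * τ * (k : ℂ) ^ 2) *
    Complex.exp (2 * Real.pi * Complex.I * (k : ℂ) * u)

/-- The Jacobi theta function `θ₄(u|τ)`. -/
def theta4 (u τ : ℂ) : ℂ :=
  ∑' k : ℤ, (-1 : ℂ) ^ k *
    Complex.exp (Real.pi * Complex.I * τ * (k : ℂ) ^ 2) *
    Complex.exp (2 * Real.pi * Complex.I * (k : ℂ) * u)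

/-- None of the four theta functions vanishes at `x`. As the zeros of the four theta functions
are exactly the points of the four cosets of `ℤ + τℤ` by the half-periods, this says that `2x`
is not in the lattice `ℤ + τℤ`. -/
def ThetaRegular (τ x : ℂ) : Prop :=
  theta1 x τ ≠ 0 ∧ theta2 x τ ≠ 0 ∧ theta3 x τ ≠ 0 ∧ theta4 x τ ≠ 0

/-- The half-periods `ω₀ = 0`, `ω₁ = 1/2`, `ω₂ = (1+τ)/2`, `ω₃ = τ/2`. -/
def halfPeriod (τ : ℂ) : Fin 4 → ℂ := ![0, 1 / 2, (1 + τ) / 2, τ / 2]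

/-- The derivatives `∂_τ ω_a`. -/
def dHalfPeriod : Fin 4 → ℂ := ![0, 0, 1 / 2, 1 / 2]

theorem hasDerivAt_halfPeriod (τ : ℂ) (a : Fin 4) :
    HasDerivAt (fun t => halfPeriod t a) (dHalfPeriod a) τ := by
  fin_cases a
  · simpa [halfPeriod, dHalfPeriod] using hasDerivAt_const τ (0 : ℂ)
  · simpa [halfPeriod, dHalfPeriod] using hasDerivAt_const τ (2⁻¹ : ℂ)
  · simpa [halfPeriod, dHalfPeriod] using ((hasDerivAt_id τ).const_add 1).div_const 2
  · simpa [halfPeriod, dHalfPeriod] using (hasDerivAt_id τ).div_const 2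

/-- The elliptic Kronecker function `φ(x,u) = θ₁'(0) θ₁(x+u) / (θ₁(x) θ₁(u))`. -/
def kronecker (τ x u : ℂ) : ℂ :=
  deriv (fun t => theta1 t τ) 0 * theta1 (x + u) τ / (theta1 x τ * theta1 u τ)

/-- `varphi τ a x u` is the function `φ_a(x, u + ω_a) = exp(2π i x ∂_τω_a) φ(x, u + ω_a)`. -/
def varphi (τ : ℂ) (a : Fin 4) (x u : ℂ) : ℂ :=
  Complex.exp (2 * Real.pi * Complex.I * x * dHalfPeriod a) * kronecker τ x (u + halfPeriod τ a)

/-- `v(x,u|ν) = ∑ₐ νₐ φ_a(2x, u + ω_a)`. -/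
def vFun (τ : ℂ) (ν : Fin 4 → ℂ) (x u : ℂ) : ℂ :=
  ∑ a : Fin 4, ν a * varphi τ a (2 * x) u

/-- The dual constants `ν̆ₐ`. -/
def nuDual (ν : Fin 4 → ℂ) : Fin 4 → ℂ :=
  ![(ν 0 + ν 1 + ν 2 + ν 3) / 2, (ν 0 + ν 1 - ν 2 - ν 3) / 2,
    (ν 0 - ν 1 + ν 2 - ν 3) / 2, (ν 0 - ν 1 - ν 2 + ν 3) / 2]

/-- Chalykh's Lax matrix of the `BC₁` Ruijsenaars-van Diejen model with the ten coupling constants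
`η, νₐ, η', ν'ₐ` (the primed ones are the barred ones). -/
def chalykhLax (τ c η : ℂ) (ν : Fin 4 → ℂ) (η' : ℂ) (ν' : Fin 4 → ℂ) (z q p : ℂ) :
    Matrix (Fin 2) (Fin 2) ℂ :=
  !![vFun τ ν η q, -vFun τ ν z q;
     -vFun τ ν z (-q), vFun τ ν η (-q)] *
  !![vFun τ ν' η' q * Complex.exp (p / c), -vFun τ ν' z q;
     -vFun τ ν' z (-q), vFun τ ν' η' (-q) * Complex.exp (-p / c)]

/-- The factor `𝐋(z)`; the second factor `𝐋̄(z)` is the same matrix with the barred constants. -/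
def laxFactor (τ c η : ℂ) (ν : Fin 4 → ℂ) (z q p : ℂ) : Matrix (Fin 2) (Fin 2) ℂ :=
  !![vFun τ ν η q * Complex.exp (p / (2 * c)), -vFun τ ν z q * Complex.exp (-p / (2 * c));
     -vFun τ ν z (-q) * Complex.exp (p / (2 * c)), vFun τ ν η (-q) * Complex.exp (-p / (2 * c))]

/-- The shifted intertwining matrix `Ξ_η(z)`; its theta functions have modulus `2τ`. -/
def xi (τ η z q : ℂ) : Matrix (Fin 2) (Fin 2) ℂ :=
  !![theta3 (z + η - 2 * q) (2 * τ), -theta3 (z + η + 2 * q) (2 * τ);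
     -theta2 (z + η - 2 * q) (2 * τ), theta2 (z + η + 2 * q) (2 * τ)]

/-- The gauge transformed first factor `𝐋'(z) = Ξ_η(z) 𝐋(z) Ξ_η(z)⁻¹`. -/
def laxFactorGauged (τ c η : ℂ) (ν : Fin 4 → ℂ) (z q p : ℂ) : Matrix (Fin 2) (Fin 2) ℂ :=
  xi τ η z q * laxFactor τ c η ν z q p * (xi τ η z q)⁻¹

/-- The Sklyanin generators `𝐒ₐ(p,q,η)`. -/
def sklyanin (τ c η q p : ℂ) (a : Fin 4) : ℂ :=
  (varphi τ a (2 * q) η * Complex.exp (p / (2 * c)) +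
    varphi τ a (-2 * q) η * Complex.exp (-p / (2 * c))) / 2

end BC1

end

noncomputable section

namespace BC1

open Complex

/-! The proof rests on one classical fact: a product `θ_a(x+y) θ_a(x-y)` of modulus `τ` is bilinear
in `θ₂, θ₃` of modulus `2τ` at `2x` and `2y`. It is proved for `θ₃` by regrouping a double series
(`theta3_mul_theta3`); the other cases follow by translation.

Three consequences are combined. The determinant of `Ξ_η(z)` is `-θ₁(z+η) θ₁(2q)` (`xi_det`), so
conjugation becomes multiplication by the adjugate. Riemann's quartic relations give the duality
`vFun_eq`: `v(x,y)` is also `∑ ν̆ₐ φ_a(2y, x+ω_a)`, so the entries of `𝐋` at `(η, q)` and `(z, -q)`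
involve the same functions with first argument `±2q`. Finally, `three_term_relations` shows that,
for each `ν̆ₐ`, every entry of `Ξ 𝐋 adj Ξ` is divisible by the determinant, with quotient linear in
the `φ_b(±2q, η+ω_b)`.

The coefficients of `e^{p/2c}` and `e^{-p/2c}` are exchanged by `q ↦ -q` and have the same quotient
coefficients, so only the combinations `𝐒_b` survive. -/

/-- Pairs of integers, split by the parity of their sum, in the coordinates half-sum and
half-difference. -/
def sumDiffEquiv : (ℤ × ℤ) ⊕ (ℤ × ℤ) ≃ ℤ × ℤ :=
  Equiv.ofBijective
    (Sum.elim (fun p => (p.1 + p.2, p.1 - p.2)) (fun p => (p.1 + p.2 + 1, p.1 - p.2))) <| by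
    constructor
    · rintro (⟨a, b⟩ | ⟨a, b⟩) (⟨c, d⟩ | ⟨c, d⟩) h <;>
        simp only [Sum.elim_inl, Sum.elim_inr, Prod.mk.injEq] at h
      · obtain ⟨rfl, rfl⟩ : a = c ∧ b = d := by omega
        rfl
      · omega
      · omega
      · obtain ⟨rfl, rfl⟩ : a = c ∧ b = d := by omega
        rfl
    · rintro ⟨k, l⟩
      rcases Int.even_or_odd' (k + l) with ⟨m, h | h⟩
      · exact ⟨Sum.inl (m, k - m), by simp; omega⟩
      · exact ⟨Sum.inr (m, k - 1 - m), by simp; omega⟩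

theorem sumDiffEquiv_inl (p : ℤ × ℤ) :
    sumDiffEquiv (Sum.inl p) = (p.1 + p.2, p.1 - p.2) := rfl

theorem sumDiffEquiv_inr (p : ℤ × ℤ) :
    sumDiffEquiv (Sum.inr p) = (p.1 + p.2 + 1, p.1 - p.2) := rfl

/-! ### Translations and parities of the theta functions -/

theorem exp_pi_int (k : ℤ) : exp (Real.pi * I * k) = (-1 : ℂ) ^ k := by
  rw [mul_comm, exp_int_mul, exp_pi_mul_I]

/-- The other three functions are translates of `θ₃` up to exponential factors, so convergence,
periods and parity are all inherited from `jacobiTheta₂`. -/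
theorem theta3_eq_jacobi (u τ : ℂ) : theta3 u τ = jacobiTheta₂ u τ := by
  refine tsum_congr fun k => ?_
  rw [jacobiTheta₂_term, ← exp_add]
  congr 1
  ring

theorem theta4_eq (u τ : ℂ) : theta4 u τ = theta3 (u + 1 / 2) τ := by
  refine tsum_congr fun k => ?_
  rw [← exp_pi_int, ← exp_add, ← exp_add, ← exp_add]
  congr 1
  ring

theorem theta2_eq (u τ : ℂ) :
    theta2 u τ = exp (Real.pi * I * (τ / 4 + u)) * theta3 (u + τ / 2) τ := by
  rw [theta2, theta3, ← tsum_mul_left]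
  refine tsum_congr fun k => ?_
  rw [← exp_add, ← exp_add, ← exp_add]
  congr 1
  ring

theorem theta1_eq (u τ : ℂ) : theta1 u τ = theta2 (u - 1 / 2) τ := by
  rw [theta2, theta1, ← tsum_mul_left]
  refine tsum_congr fun k => ?_
  have h : -I = exp (-(Real.pi / 2 * I)) := by
    rw [exp_neg, exp_pi_div_two_mul_I, inv_I]
  -- The negative exponent is chosen so that the total phase is `-πi(2k+1)/2`, a shift of `u` by
  -- `-1/2`.
  have h2 : (-1 : ℂ) ^ k = exp (-(Real.pi * I * k)) := by
    rw [exp_neg, exp_pi_int, ← inv_zpow]; norm_num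
  rw [h, h2, ← exp_add, ← exp_add, ← exp_add, ← exp_add]
  congr 1
  ring

theorem theta3_add_one (u τ : ℂ) : theta3 (u + 1) τ = theta3 u τ := by
  simp only [theta3_eq_jacobi, jacobiTheta₂_add_left]

theorem theta3_neg (u τ : ℂ) : theta3 (-u) τ = theta3 u τ := by
  simp only [theta3_eq_jacobi, jacobiTheta₂_neg_left]

theorem theta3_add_tau (u τ : ℂ) :
    theta3 (u + τ) τ = exp (-(Real.pi * I * (τ + 2 * u))) * theta3 u τ := by
  rw [theta3_eq_jacobi, theta3_eq_jacobi, jacobiTheta₂_add_left']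
  congr 2
  ring

theorem theta4_add_half (u τ : ℂ) : theta4 (u + 1 / 2) τ = theta3 u τ := by
  rw [theta4_eq, ← theta3_add_one u]
  congr 1
  ring

theorem theta1_add_half (u τ : ℂ) : theta1 (u + 1 / 2) τ = theta2 u τ := by
  rw [theta1_eq]
  congr 1
  ring

theorem theta2_add_one (u τ : ℂ) : theta2 (u + 1) τ = -theta2 u τ := by
  rw [theta2_eq, theta2_eq, show u + 1 + τ / 2 = u + τ / 2 + 1 by ring, theta3_add_one,
    show Real.pi * I * (τ / 4 + (u + 1)) = Real.pi * I * (τ / 4 + u) + Real.pi * I by ring,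
    exp_add, exp_pi_mul_I]
  ring

theorem theta2_add_half (u τ : ℂ) : theta2 (u + 1 / 2) τ = -theta1 u τ := by
  rw [theta1_eq, ← theta2_add_one]
  congr 1
  ring

theorem theta2_neg (u τ : ℂ) : theta2 (-u) τ = theta2 u τ := by
  rw [theta2_eq, theta2_eq, ← theta3_neg, show u + τ / 2 = -(-u + τ / 2) + τ by ring,
    theta3_add_tau, ← mul_assoc, ← exp_add]
  congr 2
  ring

theorem theta1_neg (u τ : ℂ) : theta1 (-u) τ = -theta1 u τ := by
  rw [← theta2_add_half, theta1_eq, ← theta2_neg]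
  congr 1
  ring

theorem theta4_neg (u τ : ℂ) : theta4 (-u) τ = theta4 u τ := by
  rw [theta4_eq, ← theta3_neg, theta4_eq, ← theta3_add_one]
  congr 1
  ring

theorem theta1_zero (τ : ℂ) : theta1 0 τ = 0 := by
  have h := theta1_neg 0 τ
  rw [neg_zero] at h
  linear_combination h / 2

theorem theta3_add_half_tau (u τ : ℂ) :
    theta3 (u + τ / 2) τ = exp (-(Real.pi * I * (τ / 4 + u))) * theta2 u τ := by
  rw [theta2_eq, ← mul_assoc, ← exp_add]
  simp

theorem theta2_add_half_tau (u τ : ℂ) :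
    theta2 (u + τ / 2) τ = exp (-(Real.pi * I * (τ / 4 + u))) * theta3 u τ := by
  rw [theta2_eq, show u + τ / 2 + τ / 2 = u + τ by ring, theta3_add_tau, ← mul_assoc, ← exp_add]
  congr 2
  ring

theorem theta1_add_half_tau (u τ : ℂ) :
    theta1 (u + τ / 2) τ = I * exp (-(Real.pi * I * (τ / 4 + u))) * theta4 u τ := by
  rw [theta1_eq, show u + τ / 2 - 1 / 2 = u - 1 / 2 + τ / 2 by ring, theta2_add_half_tau,
    theta4_eq, ← theta3_add_one]
  have h : exp (-(Real.pi * I * (τ / 4 + (u - 1 / 2)))) =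
      I * exp (-(Real.pi * I * (τ / 4 + u))) := by
    rw [show -(Real.pi * I * (τ / 4 + (u - 1 / 2))) =
      Real.pi / 2 * I + -(Real.pi * I * (τ / 4 + u)) by ring, exp_add, exp_pi_div_two_mul_I]
  rw [h]
  congr 2
  ring

theorem theta1_add_half_add_half_tau (u τ : ℂ) :
    theta1 (u + (1 + τ) / 2) τ = exp (-(Real.pi * I * (τ / 4 + u))) * theta3 u τ := by
  rw [← theta2_add_half_tau, theta1_eq]
  congr 1
  ring

/-! ### Product formulas from modulus `τ` to modulus `2τ` -/

theorem hasSum_theta3 (u : ℂ) {τ : ℂ} (hτ : 0 < τ.im) :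
    HasSum (fun k : ℤ => exp (Real.pi * I * τ * (k : ℂ) ^ 2 + 2 * Real.pi * I * k * u))
      (theta3 u τ) := by
  rw [theta3_eq_jacobi]
  refine (hasSum_jacobiTheta₂_term u hτ).congr_fun fun k => ?_
  rw [jacobiTheta₂_term, add_comm]
  congr 2
  ring

theorem hasSum_theta2 (u : ℂ) {τ : ℂ} (hτ : 0 < τ.im) :
    HasSum (fun k : ℤ => exp (Real.pi * I * τ * ((k : ℂ) + 1 / 2) ^ 2 +
      Real.pi * I * (2 * (k : ℂ) + 1) * u)) (theta2 u τ) := by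
  rw [theta2_eq]
  refine ((hasSum_theta3 (u + τ / 2) hτ).mul_left _).congr_fun fun k => ?_
  rw [← exp_add]
  congr 1
  ring

theorem hasSum_mul_prod {f g : ℤ → ℂ} {a b : ℂ} (hf : HasSum f a) (hg : HasSum g b) :
    HasSum (fun p : ℤ × ℤ => f p.1 * g p.2) (a * b) :=
  hf.mul hg (summable_mul_of_summable_norm hf.summable.norm hg.summable.norm)

/-- With `k = m+n`, `l = m-n` one has `k² + l² = 2(m² + n²)`. Pairs with `k+l` even have integral
`m, n` and give `θ₃θ₃`; pairs with `k+l` odd have half-integral `m, n` and give `θ₂θ₂`. -/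
theorem theta3_mul_theta3 (x y : ℂ) {τ : ℂ} (hτ : 0 < τ.im) :
    theta3 (x + y) τ * theta3 (x - y) τ =
      theta3 (2 * x) (2 * τ) * theta3 (2 * y) (2 * τ) +
        theta2 (2 * x) (2 * τ) * theta2 (2 * y) (2 * τ) := by
  have hτ' : 0 < (2 * τ).im := by simpa using hτ
  refine (hasSum_mul_prod (hasSum_theta3 (x + y) hτ) (hasSum_theta3 (x - y) hτ)).unique ?_
  rw [← sumDiffEquiv.hasSum_iff]
  refine HasSum.sum ?_ ?_
  · refine (hasSum_mul_prod (hasSum_theta3 (2 * x) hτ')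
      (hasSum_theta3 (2 * y) hτ')).congr_fun fun p => ?_
    simp only [Function.comp_apply, sumDiffEquiv_inl]
    rw [← exp_add, ← exp_add]
    congr 1
    push_cast
    ring
  · refine (hasSum_mul_prod (hasSum_theta2 (2 * x) hτ')
      (hasSum_theta2 (2 * y) hτ')).congr_fun fun p => ?_
    simp only [Function.comp_apply, sumDiffEquiv_inr]
    rw [← exp_add, ← exp_add]
    congr 1
    push_cast
    ring

theorem theta4_mul_theta4 (x y : ℂ) {τ : ℂ} (hτ : 0 < τ.im) :
    theta4 (x + y) τ * theta4 (x - y) τ =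
      theta3 (2 * x) (2 * τ) * theta3 (2 * y) (2 * τ) -
        theta2 (2 * x) (2 * τ) * theta2 (2 * y) (2 * τ) := by
  have h := theta3_mul_theta3 (x + 1 / 2) y hτ
  rw [show x + 1 / 2 + y = x + y + 1 / 2 by ring, show x + 1 / 2 - y = x - y + 1 / 2 by ring,
    show 2 * (x + 1 / 2) = 2 * x + 1 by ring, theta3_add_one, theta2_add_one, ← theta4_eq,
    ← theta4_eq] at h
  linear_combination h

theorem theta2_mul_theta2 (x y : ℂ) {τ : ℂ} (hτ : 0 < τ.im) :
    theta2 (x + y) τ * theta2 (x - y) τ =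
      theta3 (2 * x) (2 * τ) * theta2 (2 * y) (2 * τ) +
        theta2 (2 * x) (2 * τ) * theta3 (2 * y) (2 * τ) := by
  have h := theta3_mul_theta3 (x + τ / 2) y hτ
  rw [show x + τ / 2 + y = x + y + τ / 2 by ring, show x + τ / 2 - y = x - y + τ / 2 by ring,
    show 2 * (x + τ / 2) = 2 * x + 2 * τ / 2 by ring, theta3_add_half_tau, theta3_add_half_tau,
    theta3_add_half_tau, theta2_add_half_tau] at h
  have e : exp (-(Real.pi * I * (τ / 4 + (x + y)))) * exp (-(Real.pi * I * (τ / 4 + (x - y)))) =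
      exp (-(Real.pi * I * (2 * τ / 4 + 2 * x))) := by
    rw [← exp_add]
    congr 1
    ring
  refine mul_left_cancel₀ (exp_ne_zero (-(Real.pi * I * (2 * τ / 4 + 2 * x)))) ?_
  linear_combination h - theta2 (x + y) τ * theta2 (x - y) τ * e

theorem theta1_mul_theta1 (x y : ℂ) {τ : ℂ} (hτ : 0 < τ.im) :
    theta1 (x + y) τ * theta1 (x - y) τ =
      theta3 (2 * x) (2 * τ) * theta2 (2 * y) (2 * τ) -
        theta2 (2 * x) (2 * τ) * theta3 (2 * y) (2 * τ) := by
  have h := theta2_mul_theta2 (x + 1 / 2) y hτ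
  rw [show x + 1 / 2 + y = x + y + 1 / 2 by ring, show x + 1 / 2 - y = x - y + 1 / 2 by ring,
    show 2 * (x + 1 / 2) = 2 * x + 1 by ring, theta3_add_one, theta2_add_one, theta2_add_half,
    theta2_add_half] at h
  linear_combination h

theorem theta3_mul_theta4 (x y : ℂ) {τ : ℂ} (hτ : 0 < τ.im) :
    theta3 (x + y) τ * theta4 (x - y) τ =
      theta4 (2 * x) (2 * τ) * theta4 (2 * y) (2 * τ) -
        theta1 (2 * x) (2 * τ) * theta1 (2 * y) (2 * τ) := by
  -- Opposite quarter shifts fix `x + y` and move `x - y` by `1/2`, turning just one factor `θ₃`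
  -- into `θ₄`.
  have h := theta3_mul_theta3 (x + 1 / 4) (y - 1 / 4) hτ
  rw [show x + 1 / 4 + (y - 1 / 4) = x + y by ring,
    show x + 1 / 4 - (y - 1 / 4) = x - y + 1 / 2 by ring,
    show 2 * (x + 1 / 4) = 2 * x + 1 / 2 by ring, show 2 * (y - 1 / 4) = 2 * y - 1 / 2 by ring,
    ← theta4_eq, ← theta4_eq, theta2_add_half, ← theta1_eq,
    ← theta4_add_half (2 * y - 1 / 2), sub_add_cancel] at h
  linear_combination h

theorem theta1_mul_theta2 (x y : ℂ) {τ : ℂ} (hτ : 0 < τ.im) :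
    theta1 (x + y) τ * theta2 (x - y) τ =
      theta1 (2 * x) (2 * τ) * theta4 (2 * y) (2 * τ) +
        theta4 (2 * x) (2 * τ) * theta1 (2 * y) (2 * τ) := by
  have h := theta2_mul_theta2 (x - 1 / 4) (y - 1 / 4) hτ
  rw [show x - 1 / 4 + (y - 1 / 4) = x + y - 1 / 2 by ring,
    show x - 1 / 4 - (y - 1 / 4) = x - y by ring,
    show 2 * (x - 1 / 4) = 2 * x - 1 / 2 by ring, show 2 * (y - 1 / 4) = 2 * y - 1 / 2 by ring,
    ← theta1_eq, ← theta1_eq, ← theta1_eq, ← theta4_add_half (2 * x - 1 / 2),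
    ← theta4_add_half (2 * y - 1 / 2), sub_add_cancel, sub_add_cancel] at h
  linear_combination h

/-- The duplication formula for `θ₁`. -/
theorem theta1_two_mul (x : ℂ) {τ : ℂ} (hτ : 0 < τ.im) :
    theta1 (2 * x) τ * (theta2 0 τ * theta3 0 τ * theta4 0 τ) =
      2 * (theta1 x τ * theta2 x τ * theta3 x τ * theta4 x τ) := by
  have h1 := theta1_mul_theta2 x x hτ
  have h2 := theta3_mul_theta4 0 0 hτ
  have h3 := theta1_mul_theta2 x 0 hτ
  have h4 := theta3_mul_theta4 x 0 hτ
  simp only [sub_self, add_zero, sub_zero, mul_zero, theta1_zero, ← two_mul] at h1 h2 h3 h4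
  -- Both sides equal `2 θ₁(2x|2τ) θ₄(2x|2τ) θ₄(0|2τ)²`.
  linear_combination theta3 0 τ * theta4 0 τ * h1 +
    2 * theta1 (2 * x) (2 * τ) * theta4 (2 * x) (2 * τ) * h2 -
    2 * theta3 x τ * theta4 x τ * h3 - 2 * theta1 (2 * x) (2 * τ) * theta4 0 (2 * τ) * h4

/-! ### Half-periods and the functions `φ_a` -/

/-- The theta functions, indexed like the half-periods. -/
def theta (τ : ℂ) (a : Fin 4) (u : ℂ) : ℂ :=
  ![theta1 u τ, theta2 u τ, theta3 u τ, theta4 u τ] a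

theorem ThetaRegular.theta_ne_zero {τ x : ℂ} (h : ThetaRegular τ x) (a : Fin 4) :
    theta τ a x ≠ 0 := by
  obtain ⟨h1, h2, h3, h4⟩ := h
  fin_cases a <;> assumption

theorem ThetaRegular.neg {τ x : ℂ} (h : ThetaRegular τ x) : ThetaRegular τ (-x) := by
  obtain ⟨h1, h2, h3, h4⟩ := h
  exact ⟨by rwa [theta1_neg, neg_ne_zero], by rwa [theta2_neg], by rwa [theta3_neg],
    by rwa [theta4_neg]⟩

/-- By duplication, one regular point forces the theta constants at `0` to be nonzero as well; the
duality divides by them. -/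
theorem ThetaRegular.mul_ne_zero {τ x : ℂ} (h : ThetaRegular τ x) (hτ : 0 < τ.im) :
    theta1 (2 * x) τ * (theta2 0 τ * theta3 0 τ * theta4 0 τ) ≠ 0 := by
  rw [theta1_two_mul x hτ]
  obtain ⟨h1, h2, h3, h4⟩ := h
  simp [*]

theorem ThetaRegular.theta1_two_mul_ne_zero {τ x : ℂ} (h : ThetaRegular τ x) (hτ : 0 < τ.im) :
    theta1 (2 * x) τ ≠ 0 :=
  left_ne_zero_of_mul (h.mul_ne_zero hτ)

theorem theta1_add_halfPeriod (τ : ℂ) (a : Fin 4) (u : ℂ) :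
    theta1 (u + halfPeriod τ a) τ =
      ![1, 1, 1, I] a * exp (-(2 * Real.pi * I * (τ / 4 + u) * dHalfPeriod a)) *
        theta τ a u := by
  fin_cases a
  · simp [halfPeriod, dHalfPeriod, theta]
  · simpa [halfPeriod, dHalfPeriod, theta] using theta1_add_half u τ
  · have h := theta1_add_half_add_half_tau u τ
    rw [show Real.pi * I * (τ / 4 + u) = 2 * Real.pi * I * (τ / 4 + u) * (1 / 2) by ring] at h
    simpa [halfPeriod, dHalfPeriod, theta] using h
  · have h := theta1_add_half_tau u τ
    rw [show Real.pi * I * (τ / 4 + u) = 2 * Real.pi * I * (τ / 4 + u) * (1 / 2) by ring] at h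
    simpa [halfPeriod, dHalfPeriod, theta] using h

/-- The prefactor `exp(2πi x ∂_τω_a)` cancels the `x`-dependent part of the factor produced by
shifting `θ₁` by `ω_a`; the rest cancels in the quotient. -/
theorem varphi_eq (τ : ℂ) (a : Fin 4) (x u : ℂ) :
    varphi τ a x u = deriv (fun t => theta1 t τ) 0 * theta τ a (x + u) /
      (theta1 x τ * theta τ a u) := by
  rw [varphi, kronecker, ← add_assoc, theta1_add_halfPeriod, theta1_add_halfPeriod,
    show -(2 * Real.pi * I * (τ / 4 + (x + u)) * dHalfPeriod a) =
      -(2 * Real.pi * I * x * dHalfPeriod a) +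
        -(2 * Real.pi * I * (τ / 4 + u) * dHalfPeriod a) by ring, exp_add,
    exp_neg (2 * Real.pi * I * x * dHalfPeriod a)]
  have h1 := exp_ne_zero (2 * Real.pi * I * x * dHalfPeriod a)
  have h2 := exp_ne_zero (-(2 * Real.pi * I * (τ / 4 + u) * dHalfPeriod a))
  have h3 : (![1, 1, 1, I] a : ℂ) ≠ 0 := by fin_cases a <;> simp
  generalize exp (2 * Real.pi * I * x * dHalfPeriod a) = e1 at *
  generalize exp (-(2 * Real.pi * I * (τ / 4 + u) * dHalfPeriod a)) = e2 at *
  generalize (![1, 1, 1, I] a : ℂ) = k at *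
  calc e1 * (deriv (fun t => theta1 t τ) 0 * (k * (e1⁻¹ * e2) * theta τ a (x + u)) /
        (theta1 x τ * (k * e2 * theta τ a u)))
      = (e1 * e1⁻¹) * ((k * e2) * (deriv (fun t => theta1 t τ) 0 * theta τ a (x + u)) /
        ((k * e2) * (theta1 x τ * theta τ a u))) := by ring
    _ = _ := by
      rw [mul_inv_cancel₀ h1, one_mul, mul_div_mul_left _ _ (_root_.mul_ne_zero h3 h2)]

/-! ### Riemann's relations and the duality of `v` -/

theorem nuDual_apply (ν : Fin 4 → ℂ) (a : Fin 4) :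
    nuDual ν a = (∑ b, nuDual (Pi.single b 1) a * ν b) := by
  fin_cases a <;> simp [nuDual, Fin.sum_univ_four, Pi.single_apply] <;> ring

/-- Riemann's quartic relations at the points `(2 x + y, y, y, y)` and `(2 y + x, x, x, x)`. -/
theorem riemann_relation (x y : ℂ) {τ : ℂ} (hτ : 0 < τ.im) (a : Fin 4) :
    theta τ a (2 * x + y) * theta τ (![1, 0, 0, 0] a) y * theta τ (![2, 2, 1, 1] a) y *
        theta τ (![3, 3, 3, 2] a) y =
      nuDual (Pi.single a 1) 0 *
        (theta τ 0 (2 * y + x) * theta τ 1 x * theta τ 2 x * theta τ 3 x) +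
      nuDual (Pi.single a 1) 1 *
        (theta τ 1 (2 * y + x) * theta τ 0 x * theta τ 2 x * theta τ 3 x) +
      nuDual (Pi.single a 1) 2 *
        (theta τ 2 (2 * y + x) * theta τ 0 x * theta τ 1 x * theta τ 3 x) +
      nuDual (Pi.single a 1) 3 *
        (theta τ 3 (2 * y + x) * theta τ 0 x * theta τ 1 x * theta τ 2 x) := by
  -- Pairing `θ₁` with `θ₂` and `θ₃` with `θ₄` writes all quartic products through `θ₁, θ₄` of
  -- modulus `2τ` at `2x+2y`, `2x`, `2y`, with a common factor `θ₄(0|2τ)`. Only four monomials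
  -- occur, and the relations become linear identities among them.
  have p12 (x y : ℂ) : theta1 (2 * x + y) τ * theta2 y τ =
      theta1 (2 * x + 2 * y) (2 * τ) * theta4 (2 * x) (2 * τ) +
        theta4 (2 * x + 2 * y) (2 * τ) * theta1 (2 * x) (2 * τ) := by
    have h := theta1_mul_theta2 (x + y) x hτ
    rwa [show x + y + x = 2 * x + y by ring, add_sub_cancel_left, mul_add] at h
  have p21 (x y : ℂ) : theta2 (2 * x + y) τ * theta1 y τ =
      theta1 (2 * x + 2 * y) (2 * τ) * theta4 (2 * x) (2 * τ) -
        theta4 (2 * x + 2 * y) (2 * τ) * theta1 (2 * x) (2 * τ) := by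
    have h := theta1_mul_theta2 (x + y) (-x) hτ
    rw [show x + y - -x = 2 * x + y by ring, add_neg_cancel_comm, mul_add, mul_neg, theta4_neg,
      theta1_neg] at h
    linear_combination h
  have p34 (x y : ℂ) : theta3 (2 * x + y) τ * theta4 y τ =
      theta4 (2 * x + 2 * y) (2 * τ) * theta4 (2 * x) (2 * τ) -
        theta1 (2 * x + 2 * y) (2 * τ) * theta1 (2 * x) (2 * τ) := by
    have h := theta3_mul_theta4 (x + y) x hτ
    rwa [show x + y + x = 2 * x + y by ring, add_sub_cancel_left, mul_add] at h
  have p43 (x y : ℂ) : theta4 (2 * x + y) τ * theta3 y τ =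
      theta4 (2 * x + 2 * y) (2 * τ) * theta4 (2 * x) (2 * τ) +
        theta1 (2 * x + 2 * y) (2 * τ) * theta1 (2 * x) (2 * τ) := by
    have h := theta3_mul_theta4 (x + y) (-x) hτ
    rw [show x + y - -x = 2 * x + y by ring, add_neg_cancel_comm, mul_add, mul_neg, theta4_neg,
      theta1_neg] at h
    linear_combination h
  have d12 (y : ℂ) : theta1 y τ * theta2 y τ = theta1 (2 * y) (2 * τ) * theta4 0 (2 * τ) := by
    simpa [theta1_zero] using theta1_mul_theta2 y 0 hτ
  have d34 (y : ℂ) : theta3 y τ * theta4 y τ = theta4 (2 * y) (2 * τ) * theta4 0 (2 * τ) := by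
    simpa [theta1_zero] using theta3_mul_theta4 y 0 hτ
  have r1 : theta1 (2 * y + x) τ * theta2 x τ * theta3 x τ * theta4 x τ = _ :=
    (mul_assoc _ _ _).trans (congr_arg₂ (· * ·) (p12 y x) (d34 x))
  have r2 : theta2 (2 * y + x) τ * theta1 x τ * theta3 x τ * theta4 x τ = _ :=
    (mul_assoc _ _ _).trans (congr_arg₂ (· * ·) (p21 y x) (d34 x))
  have r3 : theta3 (2 * y + x) τ * theta1 x τ * theta2 x τ * theta4 x τ = _ :=
    (show _ = theta3 (2 * y + x) τ * theta4 x τ * (theta1 x τ * theta2 x τ) by ring).trans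
      (congr_arg₂ (· * ·) (p34 y x) (d12 x))
  have r4 : theta4 (2 * y + x) τ * theta1 x τ * theta2 x τ * theta3 x τ = _ :=
    (show _ = theta4 (2 * y + x) τ * theta3 x τ * (theta1 x τ * theta2 x τ) by ring).trans
      (congr_arg₂ (· * ·) (p43 y x) (d12 x))
  have l1 : theta1 (2 * x + y) τ * theta2 y τ * theta3 y τ * theta4 y τ = _ :=
    (mul_assoc _ _ _).trans (congr_arg₂ (· * ·) (p12 x y) (d34 y))
  have l2 : theta2 (2 * x + y) τ * theta1 y τ * theta3 y τ * theta4 y τ = _ :=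
    (mul_assoc _ _ _).trans (congr_arg₂ (· * ·) (p21 x y) (d34 y))
  have l3 : theta3 (2 * x + y) τ * theta1 y τ * theta2 y τ * theta4 y τ = _ :=
    (show _ = theta3 (2 * x + y) τ * theta4 y τ * (theta1 y τ * theta2 y τ) by ring).trans
      (congr_arg₂ (· * ·) (p34 x y) (d12 y))
  have l4 : theta4 (2 * x + y) τ * theta1 y τ * theta2 y τ * theta3 y τ = _ :=
    (show _ = theta4 (2 * x + y) τ * theta3 y τ * (theta1 y τ * theta2 y τ) by ring).trans
      (congr_arg₂ (· * ·) (p43 x y) (d12 y))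
  rw [add_comm (2 * x) (2 * y)] at l1 l2 l3 l4
  fin_cases a <;> simp [theta, nuDual, r1, r2, r3, r4, l1, l2, l3, l4] <;> ring

/-- Duality between the parameters `ν` and `ν̆`, exchanging the two arguments of `v`. -/
theorem vFun_eq (ν : Fin 4 → ℂ) {x y τ : ℂ} (hτ : 0 < τ.im) (hx : ThetaRegular τ x)
    (hy : ThetaRegular τ y) :
    vFun τ ν x y = ∑ a, nuDual ν a * varphi τ a (2 * y) x := by
  have hb (a : Fin 4) : varphi τ a (2 * x) y =
      ∑ b, nuDual (Pi.single a 1) b * varphi τ b (2 * y) x := by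
    have h := riemann_relation x y hτ a
    have hK := hx.mul_ne_zero hτ
    have dx := theta1_two_mul x hτ
    have dy := theta1_two_mul y hτ
    have tx := hx.theta_ne_zero
    have ty := hy.theta_ne_zero
    replace hK := right_ne_zero_of_mul hK
    have ex : theta1 (2 * x) τ = 2 * (theta τ 0 x * theta τ 1 x * theta τ 2 x * theta τ 3 x) /
      (theta2 0 τ * theta3 0 τ * theta4 0 τ) := (eq_div_iff hK).2 dx
    have ey : theta1 (2 * y) τ = 2 * (theta τ 0 y * theta τ 1 y * theta τ 2 y * theta τ 3 y) /
      (theta2 0 τ * theta3 0 τ * theta4 0 τ) := (eq_div_iff hK).2 dy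
    simp only [varphi_eq, ex, ey, Fin.sum_univ_four]
    generalize theta2 0 τ * theta3 0 τ * theta4 0 τ = K at *
    generalize deriv (fun t => theta1 t τ) 0 = D
    have tx0 := tx 0
    have tx1 := tx 1
    have tx2 := tx 2
    have tx3 := tx 3
    -- The product of all four thetas at `y`, coming from `θ₁(2y)`, is split into `θ_a(y)` and the
    -- three factors on the left of the Riemann relation.
    have el : theta τ 0 y * theta τ 1 y * theta τ 2 y * theta τ 3 y = theta τ a y *
        (theta τ (![1, 0, 0, 0] a) y * theta τ (![2, 2, 1, 1] a) y *
        theta τ (![3, 3, 3, 2] a) y) := by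
      fin_cases a <;> dsimp <;> ring
    have hB : theta τ (![1, 0, 0, 0] a) y * theta τ (![2, 2, 1, 1] a) y *
        theta τ (![3, 3, 3, 2] a) y ≠ 0 := by simp [ty]
    have hya := ty a
    rw [el]
    rw [mul_assoc, mul_assoc, ← mul_assoc (theta τ _ y)] at h
    generalize theta τ (![1, 0, 0, 0] a) y * theta τ (![2, 2, 1, 1] a) y *
        theta τ (![3, 3, 3, 2] a) y = B at *
    trans D * K * (theta τ a (2 * x + y) * B) / (2 * (theta τ 0 x * theta τ 1 x * theta τ 2 x *
      theta τ 3 x) * (theta τ a y * B))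
    · field_simp
    · rw [h]
      field_simp
  rw [vFun]
  simp only [hb, nuDual_apply ν, Fin.sum_univ_four]
  ring

/-! ### Three-term relations and the gauge transformed entries -/

theorem theta_mul_theta (a : Fin 4) (x y : ℂ) {τ : ℂ} (hτ : 0 < τ.im) :
    theta τ a (x + y) * theta τ a (x - y) =
      ![theta3 (2 * x) (2 * τ) * theta2 (2 * y) (2 * τ) -
          theta2 (2 * x) (2 * τ) * theta3 (2 * y) (2 * τ),
        theta3 (2 * x) (2 * τ) * theta2 (2 * y) (2 * τ) +
          theta2 (2 * x) (2 * τ) * theta3 (2 * y) (2 * τ),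
        theta3 (2 * x) (2 * τ) * theta3 (2 * y) (2 * τ) +
          theta2 (2 * x) (2 * τ) * theta2 (2 * y) (2 * τ),
        theta3 (2 * x) (2 * τ) * theta3 (2 * y) (2 * τ) -
          theta2 (2 * x) (2 * τ) * theta2 (2 * y) (2 * τ)] a := by
  fin_cases a
  · exact theta1_mul_theta1 x y hτ
  · exact theta2_mul_theta2 x y hτ
  · exact theta3_mul_theta3 x y hτ
  · exact theta4_mul_theta4 x y hτ

/-- Sign of the off-diagonal contribution of each `ν̆ₐ`. -/
def offDiagSign : Fin 4 → ℂ := ![-1, 1, 1, -1]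

/-- The gauge transformed matrix as a function of four generators, for dual constants `μ`. -/
def gaugedMatrix (τ η z : ℂ) (μ S : Fin 4 → ℂ) : Matrix (Fin 2) (Fin 2) ℂ :=
  let T : Fin 4 → Fin 4 → ℂ := fun a b =>
    S b * (theta τ b η / theta τ a η) * (theta τ b z / theta τ a z)
  !![∑ a, μ a * (S a - T a (![1, 0, 3, 2] a)),
     ∑ a, μ a * (offDiagSign a * (T a (![2, 3, 0, 1] a) + T a (![3, 2, 1, 0] a)));
     ∑ a, μ a * (offDiagSign a * (-T a (![2, 3, 0, 1] a) + T a (![3, 2, 1, 0] a))),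
     ∑ a, μ a * (S a + T a (![1, 0, 3, 2] a))]

/-- The three-term quartic relations behind the entries of the gauge transformed matrix. -/
theorem three_term_relations (η z q : ℂ) {τ : ℂ} (hτ : 0 < τ.im) (a : Fin 4) :
    let R : Fin 4 → ℂ := fun b => theta τ b (2 * q + η) * theta τ b z
    let R' := theta τ a (-2 * q + z) * theta τ a η
    let Δ := theta1 (z + η) τ * theta1 (2 * q) τ
    let X₂ := theta2 (z + η + 2 * q) (2 * τ)
    let X₃ := theta3 (z + η + 2 * q) (2 * τ)
    let Y₂ := theta2 (z + η - 2 * q) (2 * τ)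
    let Y₃ := theta3 (z + η - 2 * q) (2 * τ)
    2 * (Y₃ * X₂ * R a - X₃ * X₂ * R') = -Δ * (R a - R (![1, 0, 3, 2] a)) ∧
    2 * (Y₃ * X₃ * R a - X₃ * X₃ * R') =
      -Δ * (offDiagSign a * (R (![2, 3, 0, 1] a) + R (![3, 2, 1, 0] a))) ∧
    2 * (-Y₂ * X₂ * R a + X₂ * X₂ * R') =
      -Δ * (offDiagSign a * (-R (![2, 3, 0, 1] a) + R (![3, 2, 1, 0] a))) ∧
    2 * (-Y₂ * X₃ * R a + X₂ * X₃ * R') = -Δ * (R a + R (![1, 0, 3, 2] a)) := by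
  intro R R' Δ X₂ X₃ Y₂ Y₃
  -- With these half-arguments `R` is bilinear in `X, Z`, `R'` is the same form in `Y, Z` since `θ₂,
  -- θ₃` are even, and `Δ = X₃Y₂ - X₂Y₃`. Hence `Y₃R - X₃R'` and `Y₂R - X₂R'` are multiples of `Δ`,
  -- and the claims are polynomial identities in six variables.
  have hR (b : Fin 4) := theta_mul_theta b ((z + η + 2 * q) / 2) ((2 * q + η - z) / 2) hτ
  have hR' := theta_mul_theta a ((z + η - 2 * q) / 2) (-((2 * q + η - z) / 2)) hτ
  have hΔ := theta1_mul_theta1 ((z + η + 2 * q) / 2) ((z + η - 2 * q) / 2) hτ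
  have e1 : (z + η + 2 * q) / 2 + (2 * q + η - z) / 2 = 2 * q + η := by ring
  have e2 : (z + η + 2 * q) / 2 - (2 * q + η - z) / 2 = z := by ring
  have e3 : (z + η - 2 * q) / 2 + -((2 * q + η - z) / 2) = -2 * q + z := by ring
  have e4 : (z + η - 2 * q) / 2 - -((2 * q + η - z) / 2) = η := by ring
  have e5 : (z + η + 2 * q) / 2 + (z + η - 2 * q) / 2 = z + η := by ring
  have e6 : (z + η + 2 * q) / 2 - (z + η - 2 * q) / 2 = 2 * q := by ring
  have e7 (x : ℂ) : 2 * (x / 2) = x := by ring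
  simp only [e1, e2, e3, e4, e5, e6, e7, mul_neg, theta2_neg, theta3_neg] at hR hR' hΔ
  change ∀ b, R b = _ at hR
  change R' = _ at hR'
  change Δ = _ at hΔ
  simp only [hR, hR', hΔ, X₂, X₃, Y₂, Y₃]
  generalize theta2 (2 * q + η - z) (2 * τ) = Z₂
  generalize theta3 (2 * q + η - z) (2 * τ) = Z₃
  generalize theta2 (z + η + 2 * q) (2 * τ) = X₂
  generalize theta3 (z + η + 2 * q) (2 * τ) = X₃
  generalize theta2 (z + η - 2 * q) (2 * τ) = Y₂
  generalize theta3 (z + η - 2 * q) (2 * τ) = Y₃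
  fin_cases a <;> dsimp [offDiagSign] <;> refine ⟨?_, ?_, ?_, ?_⟩ <;> ring

theorem gaugedMatrix_add_smul (τ η z : ℂ) (μ S S' : Fin 4 → ℂ) (r r' : ℂ) (i j : Fin 2) :
    gaugedMatrix τ η z μ (fun a => r * S a + r' * S' a) i j =
      r * gaugedMatrix τ η z μ S i j + r' * gaugedMatrix τ η z μ S' i j := by
  fin_cases i <;> fin_cases j <;> simp [gaugedMatrix, Fin.sum_univ_four] <;> ring

/-- The part of the gauge transformed matrix coming from the first column of the Lax factor. -/
theorem gauged_column (ν : Fin 4 → ℂ) {τ η z q : ℂ} (hτ : 0 < τ.im) (hη : ThetaRegular τ η)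
    (hz : ThetaRegular τ z) (hq : ThetaRegular τ q) :
    let G := gaugedMatrix τ η z (nuDual ν) fun a => varphi τ a (2 * q) η / 2
    let Δ := theta1 (z + η) τ * theta1 (2 * q) τ
    let V := vFun τ ν η q
    let W := vFun τ ν z (-q)
    let X₂ := theta2 (z + η + 2 * q) (2 * τ)
    let X₃ := theta3 (z + η + 2 * q) (2 * τ)
    let Y₂ := theta2 (z + η - 2 * q) (2 * τ)
    let Y₃ := theta3 (z + η - 2 * q) (2 * τ)
    (Y₃ * V + X₃ * W) * X₂ = -Δ * G 0 0 ∧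
    (Y₃ * V + X₃ * W) * X₃ = -Δ * G 0 1 ∧
    (-Y₂ * V - X₂ * W) * X₂ = -Δ * G 1 0 ∧
    (-Y₂ * V - X₂ * W) * X₃ = -Δ * G 1 1 := by
  intro G Δ V W X₂ X₃ Y₂ Y₃
  have hV : V = ∑ a, nuDual ν a * varphi τ a (2 * q) η := vFun_eq ν hτ hη hq
  have hW : W = ∑ a, nuDual ν a * varphi τ a (-2 * q) z := by
    rw [show -2 * q = 2 * -q by ring]
    exact vFun_eq ν hτ hz hq.neg
  -- The common denominator of the `a`-th terms. The oddness of `θ₁` gives `φ_a(-2q, z)` the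
  -- opposite sign, matching the difference in the three-term relations.
  let m : Fin 4 → ℂ := fun a =>
    deriv (fun t => theta1 t τ) 0 / (theta1 (2 * q) τ * theta τ a η * theta τ a z)
  let R : Fin 4 → ℂ := fun b => theta τ b (2 * q + η) * theta τ b z
  let R' : Fin 4 → ℂ := fun a => theta τ a (-2 * q + z) * theta τ a η
  have tη := hη.theta_ne_zero
  have tz := hz.theta_ne_zero
  have tq := hq.theta1_two_mul_ne_zero hτ
  have hφ (a : Fin 4) : varphi τ a (2 * q) η = m a * R a := by
    have h1 := tη a
    have h2 := tz a
    simp only [varphi_eq, m, R]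
    field_simp
  have hφ' (a : Fin 4) : varphi τ a (-2 * q) z = -(m a * R' a) := by
    have h1 := tη a
    have h2 := tz a
    simp only [varphi_eq, m, R']
    rw [show -2 * q = -(2 * q) by ring, theta1_neg]
    field_simp
  have hT (a b : Fin 4) : varphi τ b (2 * q) η / 2 * (theta τ b η / theta τ a η) *
      (theta τ b z / theta τ a z) = m a * R b / 2 := by
    have h1 := tη a
    have h2 := tz a
    have h3 := tη b
    simp only [varphi_eq, m, R]
    field_simp
  have key := three_term_relations η z q hτ
  dsimp only at key
  change ∀ a, 2 * (Y₃ * X₂ * R a - X₃ * X₂ * R' a) = -Δ * (R a - R (![1, 0, 3, 2] a)) ∧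
    2 * (Y₃ * X₃ * R a - X₃ * X₃ * R' a) =
      -Δ * (offDiagSign a * (R (![2, 3, 0, 1] a) + R (![3, 2, 1, 0] a))) ∧
    2 * (-Y₂ * X₂ * R a + X₂ * X₂ * R' a) =
      -Δ * (offDiagSign a * (-R (![2, 3, 0, 1] a) + R (![3, 2, 1, 0] a))) ∧
    2 * (-Y₂ * X₃ * R a + X₂ * X₃ * R' a) = -Δ * (R a + R (![1, 0, 3, 2] a)) at key
  simp only [G, gaugedMatrix, hT, Matrix.of_apply, Matrix.cons_val', Matrix.cons_val_zero,
    Matrix.cons_val_one, Matrix.cons_val_fin_one]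
  rw [hV, hW]
  simp only [hφ, hφ']
  clear_value m R R' Δ X₂ X₃ Y₂ Y₃
  refine ⟨?_, ?_, ?_, ?_⟩
  · have h (a : Fin 4) := (key a).1
    rw [Finset.mul_sum, Finset.mul_sum, Finset.mul_sum, ← Finset.sum_add_distrib, Finset.sum_mul]
    refine Finset.sum_congr rfl fun a _ => ?_
    linear_combination nuDual ν a * m a / 2 * h a
  · have h (a : Fin 4) := (key a).2.1
    rw [Finset.mul_sum, Finset.mul_sum, Finset.mul_sum, ← Finset.sum_add_distrib, Finset.sum_mul]
    refine Finset.sum_congr rfl fun a _ => ?_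
    linear_combination nuDual ν a * m a / 2 * h a
  · have h (a : Fin 4) := (key a).2.2.1
    rw [Finset.mul_sum, Finset.mul_sum, Finset.mul_sum, ← Finset.sum_sub_distrib, Finset.sum_mul]
    refine Finset.sum_congr rfl fun a _ => ?_
    linear_combination nuDual ν a * m a / 2 * h a
  · have h (a : Fin 4) := (key a).2.2.2
    rw [Finset.mul_sum, Finset.mul_sum, Finset.mul_sum, ← Finset.sum_sub_distrib, Finset.sum_mul]
    refine Finset.sum_congr rfl fun a _ => ?_
    linear_combination nuDual ν a * m a / 2 * h a

/-! ### The determinant, the conjugation and the factorization -/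

theorem xi_det (η z q : ℂ) {τ : ℂ} (hτ : 0 < τ.im) :
    (xi τ η z q).det = -(theta1 (z + η) τ * theta1 (2 * q) τ) := by
  have h := theta1_mul_theta1 ((z + η + 2 * q) / 2) ((z + η - 2 * q) / 2) hτ
  rw [show (z + η + 2 * q) / 2 + (z + η - 2 * q) / 2 = z + η by ring,
    show (z + η + 2 * q) / 2 - (z + η - 2 * q) / 2 = 2 * q by ring,
    mul_div_cancel₀ _ two_ne_zero, mul_div_cancel₀ _ two_ne_zero] at h
  rw [xi, Matrix.det_fin_two_of, h]
  ring

theorem xi_det_ne_zero {τ η z q : ℂ} (hτ : 0 < τ.im) (hzη : theta1 (z + η) τ ≠ 0)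
    (hq : ThetaRegular τ q) : (xi τ η z q).det ≠ 0 := by
  rw [xi_det η z q hτ]
  exact neg_ne_zero.2 (_root_.mul_ne_zero hzη (hq.theta1_two_mul_ne_zero hτ))

theorem laxFactorGauged_eq (c : ℂ) (ν : Fin 4 → ℂ) (p : ℂ) {τ η z q : ℂ} (hτ : 0 < τ.im)
    (hη : ThetaRegular τ η) (hz : ThetaRegular τ z) (hzη : theta1 (z + η) τ ≠ 0)
    (hq : ThetaRegular τ q) :
    laxFactorGauged τ c η ν z q p = gaugedMatrix τ η z (nuDual ν) (sklyanin τ c η q p) := by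
  have hdet := xi_det_ne_zero hτ hzη hq
  have h := gauged_column ν hτ hη hz hq
  -- The reflection `q ↦ -q` swaps `X` with `Y` and changes the sign of the determinant, so the
  -- second column of `𝐋` needs no separate computation.
  have h' := gauged_column ν hτ hη hz hq.neg
  dsimp only at h h'
  have e : sklyanin τ c η q p = fun a => exp (p / (2 * c)) * (varphi τ a (2 * q) η / 2) +
      exp (-p / (2 * c)) * (varphi τ a (2 * -q) η / 2) := by
    funext a
    rw [sklyanin, show 2 * -q = -2 * q by ring]
    ring
  have key : xi τ η z q * laxFactor τ c η ν z q p * (xi τ η z q).adjugate =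
      (xi τ η z q).det • gaugedMatrix τ η z (nuDual ν) (sklyanin τ c η q p) := by
    rw [e, xi_det η z q hτ, xi, laxFactor, Matrix.adjugate_fin_two_of]
    rw [neg_neg, show z + η + 2 * -q = z + η - 2 * q by ring,
      show z + η - 2 * -q = z + η + 2 * q by ring, show 2 * -q = -(2 * q) by ring,
      theta1_neg] at h'
    rw [show 2 * -q = -(2 * q) by ring]
    obtain ⟨h1, h2, h3, h4⟩ := h
    obtain ⟨h1', h2', h3', h4'⟩ := h'
    ext i j
    rw [Matrix.smul_apply, gaugedMatrix_add_smul]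
    fin_cases i <;> fin_cases j <;> simp [Matrix.mul_apply, Fin.sum_univ_two]
    · linear_combination exp (p / (2 * c)) * h1 - exp (-p / (2 * c)) * h1'
    · linear_combination exp (p / (2 * c)) * h2 - exp (-p / (2 * c)) * h2'
    · linear_combination exp (p / (2 * c)) * h3 - exp (-p / (2 * c)) * h3'
    · linear_combination exp (p / (2 * c)) * h4 - exp (-p / (2 * c)) * h4'
  rw [laxFactorGauged, Matrix.inv_def, Matrix.mul_smul, key, Ring.inverse_eq_inv', smul_smul,
    inv_mul_cancel₀ hdet, one_smul]

/-- With `D = diag(e^{p/2c}, e^{-p/2c})` and `M`, `M̄` the matrices of values of `v`, `v̄`,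
Chalykh's second factor is `D M̄ D`, while `𝐋 = M D` and `𝐋̄ = M̄ D`. -/
theorem chalykhLax_eq_mul (τ c η : ℂ) (ν : Fin 4 → ℂ) (η' : ℂ) (ν' : Fin 4 → ℂ) (z q p : ℂ) :
    chalykhLax τ c η ν η' ν' z q p = laxFactor τ c η ν z q p * laxFactor τ c η' ν' z q p := by
  have h1 : exp (p / c) = exp (p / (2 * c)) * exp (p / (2 * c)) := by
    rw [← exp_add]
    congr 1
    ring
  have h2 : exp (-p / c) = exp (-p / (2 * c)) * exp (-p / (2 * c)) := by
    rw [← exp_add]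
    congr 1
    ring
  have h3 : exp (p / (2 * c)) * exp (-p / (2 * c)) = 1 := by
    rw [← exp_add, neg_div, add_neg_cancel, exp_zero]
  rw [chalykhLax, laxFactor, laxFactor, h1, h2]
  generalize exp (p / (2 * c)) = E at *
  generalize exp (-p / (2 * c)) = E' at *
  simp only [Matrix.mul_fin_two]
  congr 1
  ext i j
  fin_cases i <;> fin_cases j <;> simp
  · linear_combination -vFun τ ν z q * vFun τ ν' z (-q) * h3
  · linear_combination vFun τ ν η q * vFun τ ν' z q * h3
  · linear_combination vFun τ ν η (-q) * vFun τ ν' z (-q) * h3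
  · linear_combination -vFun τ ν z (-q) * vFun τ ν' z q * h3

end BC1

end

theorem theorem3 (τ : ℂ) (hτ : 0 < τ.im) (c : ℂ) (hc : c ≠ 0)
    (η : ℂ) (ν : Fin 4 → ℂ) (z : ℂ)
    (hη : BC1.ThetaRegular τ η) (hz : BC1.ThetaRegular τ z)
    (hzη : BC1.theta1 (z + η) τ ≠ 0) :
    -- the factorization of Chalykh's matrix, before and after the gauge transformation
    (∀ (η' : ℂ) (ν' : Fin 4 → ℂ) (q p : ℂ),
      BC1.ThetaRegular τ η' → BC1.ThetaRegular τ q →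
        BC1.chalykhLax τ c η ν η' ν' z q p =
          BC1.laxFactor τ c η ν z q p * BC1.laxFactor τ c η' ν' z q p ∧
        BC1.xi τ η z q * BC1.chalykhLax τ c η ν η' ν' z q p * (BC1.xi τ η z q)⁻¹ =
          BC1.laxFactorGauged τ c η ν z q p *
            (BC1.xi τ η z q * BC1.laxFactor τ c η' ν' z q p * (BC1.xi τ η z q)⁻¹)) ∧
    -- the gauge matrix is invertible
    (∀ q : ℂ, BC1.ThetaRegular τ q → IsUnit (BC1.xi τ η z q).det) ∧
    -- the gauge transformed factor is a function of the Sklyanin generators only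
    ∃ F : (Fin 4 → ℂ) → Matrix (Fin 2) (Fin 2) ℂ,
      (∀ q p : ℂ, BC1.ThetaRegular τ q →
        BC1.laxFactorGauged τ c η ν z q p = F (BC1.sklyanin τ c η q p)) ∧
      -- the explicit entries
      ∀ S : Fin 4 → ℂ,
        F S 0 0 =
          (∑ a : Fin 4, BC1.nuDual ν a * S a)
          - BC1.nuDual ν 0 * S 1 * (BC1.theta2 η τ / BC1.theta1 η τ)
              * (BC1.theta2 z τ / BC1.theta1 z τ)
          - BC1.nuDual ν 1 * S 0 * (BC1.theta1 η τ / BC1.theta2 η τ)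
              * (BC1.theta1 z τ / BC1.theta2 z τ)
          - BC1.nuDual ν 2 * S 3 * (BC1.theta4 η τ / BC1.theta3 η τ)
              * (BC1.theta4 z τ / BC1.theta3 z τ)
          - BC1.nuDual ν 3 * S 2 * (BC1.theta3 η τ / BC1.theta4 η τ)
              * (BC1.theta3 z τ / BC1.theta4 z τ) ∧
        F S 1 1 =
          (∑ a : Fin 4, BC1.nuDual ν a * S a)
          + BC1.nuDual ν 0 * S 1 * (BC1.theta2 η τ / BC1.theta1 η τ)
              * (BC1.theta2 z τ / BC1.theta1 z τ)
          + BC1.nuDual ν 1 * S 0 * (BC1.theta1 η τ / BC1.theta2 η τ)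
              * (BC1.theta1 z τ / BC1.theta2 z τ)
          + BC1.nuDual ν 2 * S 3 * (BC1.theta4 η τ / BC1.theta3 η τ)
              * (BC1.theta4 z τ / BC1.theta3 z τ)
          + BC1.nuDual ν 3 * S 2 * (BC1.theta3 η τ / BC1.theta4 η τ)
              * (BC1.theta3 z τ / BC1.theta4 z τ) ∧
        F S 0 1 =
          (- BC1.nuDual ν 0 * S 2 * (BC1.theta3 η τ / BC1.theta1 η τ)
              * (BC1.theta3 z τ / BC1.theta1 z τ)
          + BC1.nuDual ν 1 * S 3 * (BC1.theta4 η τ / BC1.theta2 η τ)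
              * (BC1.theta4 z τ / BC1.theta2 z τ)
          + BC1.nuDual ν 2 * S 0 * (BC1.theta1 η τ / BC1.theta3 η τ)
              * (BC1.theta1 z τ / BC1.theta3 z τ)
          - BC1.nuDual ν 3 * S 1 * (BC1.theta2 η τ / BC1.theta4 η τ)
              * (BC1.theta2 z τ / BC1.theta4 z τ))
          + (- BC1.nuDual ν 0 * S 3 * (BC1.theta4 η τ / BC1.theta1 η τ)
              * (BC1.theta4 z τ / BC1.theta1 z τ)
          + BC1.nuDual ν 1 * S 2 * (BC1.theta3 η τ / BC1.theta2 η τ)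
              * (BC1.theta3 z τ / BC1.theta2 z τ)
          + BC1.nuDual ν 2 * S 1 * (BC1.theta2 η τ / BC1.theta3 η τ)
              * (BC1.theta2 z τ / BC1.theta3 z τ)
          - BC1.nuDual ν 3 * S 0 * (BC1.theta1 η τ / BC1.theta4 η τ)
              * (BC1.theta1 z τ / BC1.theta4 z τ)) ∧
        F S 1 0 =
          - (- BC1.nuDual ν 0 * S 2 * (BC1.theta3 η τ / BC1.theta1 η τ)
              * (BC1.theta3 z τ / BC1.theta1 z τ)
          + BC1.nuDual ν 1 * S 3 * (BC1.theta4 η τ / BC1.theta2 η τ)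
              * (BC1.theta4 z τ / BC1.theta2 z τ)
          + BC1.nuDual ν 2 * S 0 * (BC1.theta1 η τ / BC1.theta3 η τ)
              * (BC1.theta1 z τ / BC1.theta3 z τ)
          - BC1.nuDual ν 3 * S 1 * (BC1.theta2 η τ / BC1.theta4 η τ)
              * (BC1.theta2 z τ / BC1.theta4 z τ))
          + (- BC1.nuDual ν 0 * S 3 * (BC1.theta4 η τ / BC1.theta1 η τ)
              * (BC1.theta4 z τ / BC1.theta1 z τ)
          + BC1.nuDual ν 1 * S 2 * (BC1.theta3 η τ / BC1.theta2 η τ)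
              * (BC1.theta3 z τ / BC1.theta2 z τ)
          + BC1.nuDual ν 2 * S 1 * (BC1.theta2 η τ / BC1.theta3 η τ)
              * (BC1.theta2 z τ / BC1.theta3 z τ)
          - BC1.nuDual ν 3 * S 0 * (BC1.theta1 η τ / BC1.theta4 η τ)
              * (BC1.theta1 z τ / BC1.theta4 z τ)) := by
  -- The witness `gaugedMatrix` involves only `τ, η, z` and `ν̆`, so all dependence on `p, q` passes
  -- through its last argument.
  refine ⟨fun η' ν' q p _ hq => ?_, fun q hq => ?_,
    BC1.gaugedMatrix τ η z (BC1.nuDual ν),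
    fun q p hq => BC1.laxFactorGauged_eq c ν p hτ hη hz hzη hq, fun S => ?_⟩
  · refine ⟨BC1.chalykhLax_eq_mul τ c η ν η' ν' z q p, ?_⟩
    have hu := (BC1.xi_det_ne_zero hτ hzη hq).isUnit
    rw [BC1.laxFactorGauged, BC1.chalykhLax_eq_mul]
    simp only [Matrix.mul_assoc]
    rw [Matrix.nonsing_inv_mul_cancel_left _ _ hu]
  · exact (BC1.xi_det_ne_zero hτ hzη hq).isUnit
  · refine ⟨?_, ?_, ?_, ?_⟩ <;>
      simp [BC1.gaugedMatrix, BC1.theta, BC1.offDiagSign, Fin.sum_univ_four] <;> ring
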